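/- **Theorem 1 (Aubin–Lions–Dubinskiĭ).** Let $B$ and $Y$ be (real) Banach spaces, regarded as linear subspaces of a common vector space (no topology on that space, and no embedding $B\hookrightarrow Y$, is assumed). Let $M_+$ be a *seminormed nonnegative cone* in $B$, that is, a set $M_+\subset B$ such that $cu\in M_+$ for all $u\in M_+$ and $c\ge 0$, together with a function $[\cdot]:M_+\to[0,\infty)$ such that $[u]=0$ if and only if $u=0$, and $[cu]=c[u]$ for all $u\in M_+$, $c\ge0$. Suppose $M_+\cap Y\ne\emptyset$. Let $1\le p\le\infty$ and $0<T<\infty$. Write $u\in L^p(0,T;M_+\cap Y)$ if $u$ is a (class of a) function on $(0,T)$ that is strongly measurable both with values in $B$ and with values in $Y$, satisfies $u(t)\in M_+\cap Y$ for almost every $t$, and for which $t\mapsto[u(t)]$ belongs to $L^p(0,T)$; put $\|u\|_{L^p(0,T;M_+)}=\|[u(\cdot)]\|_{L^p(0,T)}$. For $h>0$ let $(\sigma_hu)(t)=u(t+h)$. Assume that 1. $M_+\hookrightarrow B$ compactly: every sequence $(u_n)\subset M_+$ with $\sup_n[u_n]<\infty$ has a subsequence converging in $B$; 2. for all sequences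 $(w_n)\subset B\cap Y$ and all $w\in B$: if $w_n\to w$ in $B$ and $w_n\to0$ in $Y$ as $n\to\infty$, then $w=0$; 3. $U\subset L^p(0,T;M_+\cap Y)$, and $\sup_{u\in U}\|u\|_{L^p(0,T;M_+)}<\infty$; 4. $\|\sigma_hu-u\|_{L^p(0,T-h;Y)}\to0$ as $h\to0^+$, uniformly in $u\in U$. Then $U$ is contained in $L^p(0,T;B)$ and is relatively compact there. If $p=\infty$, then moreover every $u\in U$ has a representative in $C^0([0,T];B)$, and the set of these representatives is relatively compact in $C^0([0,T];B)$. -/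

import Mathlib

open MeasureTheory Filter Topology Set
open scoped ENNReal

/-- A seminormed nonnegative cone in a Banach space `B`: a subset of `B` closed under multiplication
by `c ≥ 0`, with a nonnegative, definite, positively homogeneous function `[·]` on it. The values of
`bracket` off the carrier are irrelevant. -/
structure SeminormedNonnegCone (B : Type*) [NormedAddCommGroup B] [NormedSpace ℝ B] where
  carrier : Set B
  smul_mem : ∀ u ∈ carrier, ∀ c : ℝ, 0 ≤ c → c • u ∈ carrier
  bracket : B → ℝ
  bracket_nonneg : ∀ u ∈ carrier, 0 ≤ bracket u
  bracket_eq_zero_iff : ∀ u ∈ carrier, (bracket u = 0 ↔ u = 0)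
  bracket_smul : ∀ u ∈ carrier, ∀ c : ℝ, 0 ≤ c → bracket (c • u) = c * bracket u

/-- `M ↪ B` compactly: every sequence in `M` that is bounded with respect to `[·]` has a subsequence
converging in `B`. -/
def SeminormedNonnegCone.CompactlyEmbedded {B : Type*} [NormedAddCommGroup B] [NormedSpace ℝ B]
    (M : SeminormedNonnegCone B) : Prop :=
  ∀ w : ℕ → B, (∀ n, w n ∈ M.carrier) → (∃ C : ℝ, ∀ n, M.bracket (w n) ≤ C) →
    ∃ (b : B) (φ : ℕ → ℕ), StrictMono φ ∧ Tendsto (fun n => w (φ n)) atTop (𝓝 b)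

section Pair

variable {B Y Z : Type*}
  [NormedAddCommGroup B] [NormedSpace ℝ B] [NormedAddCommGroup Y] [NormedSpace ℝ Y]
  [AddCommGroup Z] [Module ℝ Z]

/-- For `B` and `Y` regarded as linear subspaces of a vector space `Z` through injective linear maps
`jB` and `jY`, the element `b` of `B` belongs to `Y`. -/
def MemOther (jB : B →ₗ[ℝ] Z) (jY : Y →ₗ[ℝ] Z) (b : B) : Prop :=
  ∃ y : Y, jY y = jB b

open Classical in
/-- The element `b` of `B`, regarded as an element of `Y` (with the value `0` if `b` is not
in `Y`). -/
noncomputable def toOther (jB : B →ₗ[ℝ] Z) (jY : Y →ₗ[ℝ] Z) (b : B) : Y :=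
  if h : MemOther jB jY b then h.choose else 0

/-- If `w n → w₀` in `B` and `w n → 0` in `Y`, then `w₀ = 0`. -/
def LimitsCompatible (jB : B →ₗ[ℝ] Z) (jY : Y →ₗ[ℝ] Z) : Prop :=
  ∀ (w : ℕ → B) (w₀ : B), (∀ n, MemOther jB jY (w n)) → Tendsto w atTop (𝓝 w₀) →
    Tendsto (fun n => toOther jB jY (w n)) atTop (𝓝 0) → w₀ = 0

end Pair

/-- Lebesgue measure on `(0, T)`. -/
noncomputable abbrev timeMeasure (T : ℝ) : Measure ℝ := volume.restrict (Ioo 0 T)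

section TimeSpaces

variable {B Y Z : Type*}
  [NormedAddCommGroup B] [NormedSpace ℝ B] [NormedAddCommGroup Y] [NormedSpace ℝ Y]
  [AddCommGroup Z] [Module ℝ Z]

/-- `u ∈ L^p(0,T; M ∩ Y)`, for a (class of a) strongly measurable `B`-valued function `u`: almost
every value of `u` is in `M ∩ Y`, `u` is strongly measurable as a `Y`-valued function, and
`[u(·)] ∈ L^p(0,T)`. -/
def MemLpConeInter (M : SeminormedNonnegCone B) (jB : B →ₗ[ℝ] Z) (jY : Y →ₗ[ℝ] Z)
    (p : ℝ≥0∞) (T : ℝ) (u : ℝ →ₘ[timeMeasure T] B) : Prop :=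
  (∀ᵐ t ∂timeMeasure T, u t ∈ M.carrier ∧ MemOther jB jY (u t)) ∧
  AEStronglyMeasurable (fun t => toOther jB jY (u t)) (timeMeasure T) ∧
  MemLp (fun t => M.bracket (u t)) p (timeMeasure T)

/-- `U` is bounded in `L^p(0,T; M)`. -/
def BoundedInLpCone (M : SeminormedNonnegCone B) (p : ℝ≥0∞) (T : ℝ)
    (U : Set (ℝ →ₘ[timeMeasure T] B)) : Prop :=
  ∃ C : ℝ, ∀ u ∈ U, eLpNorm (fun t => M.bracket (u t)) p (timeMeasure T) ≤ ENNReal.ofReal C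

/-- `‖σ_h u - u‖_{L^p(0,T-h;Y)} → 0` as `h → 0`, `h > 0`, uniformly in `u ∈ U`,
where `(σ_h u)(t) = u(t+h)`. -/
def TimeShiftsVanish (jB : B →ₗ[ℝ] Z) (jY : Y →ₗ[ℝ] Z) (p : ℝ≥0∞) (T : ℝ)
    (U : Set (ℝ →ₘ[timeMeasure T] B)) : Prop :=
  ∀ ε : ℝ, 0 < ε → ∃ δ : ℝ, 0 < δ ∧ ∀ h : ℝ, 0 < h → h < δ → ∀ u ∈ U,
    eLpNorm (fun t => toOther jB jY (u (t + h) - u t)) p (timeMeasure (T - h))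
      ≤ ENNReal.ofReal ε

/-- The continuous function `g` on `[0,T]` is a representative of the class `u`. -/
def RepresentedBy (T : ℝ) (u : ℝ →ₘ[timeMeasure T] B) (g : C(Icc (0 : ℝ) T, B)) : Prop :=
  ∀ᵐ t ∂timeMeasure T, ∀ ht : t ∈ Icc (0 : ℝ) T, u t = g ⟨t, ht⟩

end TimeSpaces

/-!
The three hypotheses relating the cone, `B` and `Y` combine into an Ehrling-type inequality for
differences of elements `u, v` of `M ∩ Y`,
`‖u - v‖_B ≤ ε ([u] + [v]) + K_ε ‖u - v‖_Y`.
If it failed, normalising a sequence of counterexamples by `[u] + [v]` would give, by the compactness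
of `M ↪ B`, differences converging in `B` to a nonzero limit but to `0` in `Y`
(`SeminormedNonnegCone.CompactlyEmbedded.exists_interpolation`). Applied to `u(t + h)` and `u(t)`, it
shows that the time shifts converge uniformly on `U` already in `L^p` with values in `B`
(`uniformShiftContinuity_of_timeShiftsVanish`), and `Y` plays no further role.

Fubini turns the shift estimates into a bound for the double integral of `‖u(t) - u(r)‖` near the
diagonal (`lintegral_lintegral_increment_le`), which is used in two ways.

* For `p < ∞`, cut `(0, T)` into cells of length `h` and choose one time `r_k` in each cell. Averaged
  over all choices, the step function with the values `u(r_k)` is close to `u` in `L^p`, and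
  `∑ [u(r_k)]^p` is at most `C^p / h`, so some choice makes both small enough
  (`exists_sample_times`). The sampled values then lie in one relatively compact sublevel set of
  `[·]`, so that for fixed `h` the step functions form a relatively compact set, and `U` is totally
  bounded (`totallyBounded_Lp_of_shift`). Sampling is preferred to averaging over the cells because
  the cone need not be convex.
* For `p = ∞`, almost all pairs of nearby times satisfy the modulus of continuity, so `u` is uniformly
  continuous on a set of full measure and has a continuous representative
  (`exists_representedBy`). The representatives share this modulus and take values in one compact set,
  so Arzelà–Ascoli applies (`isCompact_closure_representatives`), and compactness in `L^∞` follows.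
-/

/-! ### Elements common to both spaces, total boundedness, and the interpolation inequality -/

section Pair

variable {B Y Z : Type*}
  [NormedAddCommGroup B] [NormedSpace ℝ B] [NormedAddCommGroup Y] [NormedSpace ℝ Y]
  [AddCommGroup Z] [Module ℝ Z] {jB : B →ₗ[ℝ] Z} {jY : Y →ₗ[ℝ] Z}

theorem MemOther.sub {a b : B} (ha : MemOther jB jY a) (hb : MemOther jB jY b) :
    MemOther jB jY (a - b) := by
  obtain ⟨y, hy⟩ := ha
  obtain ⟨z, hz⟩ := hb
  exact ⟨y - z, by simp [hy, hz]⟩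

theorem MemOther.smul {a : B} (c : ℝ) (ha : MemOther jB jY a) : MemOther jB jY (c • a) := by
  obtain ⟨y, hy⟩ := ha
  exact ⟨c • y, by simp [hy]⟩

theorem apply_toOther {b : B} (h : MemOther jB jY b) : jY (toOther jB jY b) = jB b := by
  rw [toOther, dif_pos h]
  exact h.choose_spec

theorem toOther_sub (hjY : Function.Injective jY) {a b : B} (ha : MemOther jB jY a)
    (hb : MemOther jB jY b) :
    toOther jB jY (a - b) = toOther jB jY a - toOther jB jY b :=
  hjY (by rw [apply_toOther (ha.sub hb), map_sub, map_sub, apply_toOther ha, apply_toOther hb])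

theorem toOther_smul (hjY : Function.Injective jY) {a : B} (c : ℝ) (ha : MemOther jB jY a) :
    toOther jB jY (c • a) = c • toOther jB jY a :=
  hjY (by rw [apply_toOther (ha.smul c), map_smul, map_smul, apply_toOther ha])

end Pair

/-- A set in which every sequence has a subsequence converging in the ambient space (not
necessarily to a point of the set) is totally bounded. -/
theorem totallyBounded_of_subseq_tendsto {X : Type*} [PseudoMetricSpace X] {s : Set X}
    (h : ∀ w : ℕ → X, (∀ n, w n ∈ s) →
      ∃ (b : X) (φ : ℕ → ℕ), StrictMono φ ∧ Tendsto (fun n => w (φ n)) atTop (𝓝 b)) :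
    TotallyBounded s := by
  rw [Metric.totallyBounded_iff]
  by_contra! H
  obtain ⟨ε, hε, H⟩ := H
  obtain ⟨w, hw⟩ : ∃ w : ℕ → X, ∀ n, w n ∈ s ∧ ∀ m < n, w n ∉ Metric.ball (w m) ε := by
    have key : ∀ t : Finset X, (∀ y ∈ t, y ∈ s) → ∃ x, x ∈ s ∧ ∀ y ∈ t, ε ≤ dist x y := by
      intro t _
      obtain ⟨x, hxs, hx⟩ := not_subset.1 (H t t.finite_toSet)
      refine ⟨x, hxs, fun y hy => ?_⟩
      by_contra! hlt
      exact hx (mem_biUnion hy hlt)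
    obtain ⟨w, hw, hw'⟩ := exists_seq_of_forall_finset_exists (fun x => x ∈ s)
      (fun y x => ε ≤ dist x y) key
    exact ⟨w, fun n => ⟨hw n, fun m hm => by simpa using hw' m n hm⟩⟩
  obtain ⟨b, φ, hφ, hb⟩ := h w fun n => (hw n).1
  obtain ⟨N, hN⟩ := Metric.cauchySeq_iff'.1 hb.cauchySeq ε hε
  exact (hw (φ (N + 1))).2 (φ N) (hφ N.lt_succ_self) (hN (N + 1) N.le_succ)

/-- A set lying within any prescribed distance of some totally bounded set is totally bounded. -/
theorem totallyBounded_of_forall_approx {X : Type*} [PseudoMetricSpace X] {s : Set X}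
    (h : ∀ ε > 0, ∃ t : Set X, TotallyBounded t ∧ ∀ x ∈ s, ∃ y ∈ t, dist x y < ε) :
    TotallyBounded s := by
  rw [Metric.totallyBounded_iff]
  intro ε hε
  obtain ⟨t, ht, hst⟩ := h (ε / 2) (half_pos hε)
  obtain ⟨F, hF, hFt⟩ := Metric.totallyBounded_iff.1 ht (ε / 2) (half_pos hε)
  refine ⟨F, hF, fun x hx => ?_⟩
  obtain ⟨y, hy, hxy⟩ := hst x hx
  obtain ⟨z, hz, hyz⟩ := mem_iUnion₂.1 (hFt hy)
  refine mem_biUnion hz ?_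
  have := dist_triangle x y z
  rw [Metric.mem_ball] at hyz ⊢
  linarith

namespace SeminormedNonnegCone

variable {B : Type*} [NormedAddCommGroup B] [NormedSpace ℝ B] {M : SeminormedNonnegCone B}

theorem CompactlyEmbedded.totallyBounded_sublevel (hM : M.CompactlyEmbedded) (R : ℝ) :
    TotallyBounded {m | m ∈ M.carrier ∧ M.bracket m ≤ R} :=
  totallyBounded_of_subseq_tendsto fun w hw => hM w (fun n => (hw n).1) ⟨R, fun n => (hw n).2⟩

theorem CompactlyEmbedded.isCompact_closure_sublevel [CompleteSpace B]
    (hM : M.CompactlyEmbedded) (R : ℝ) :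
    IsCompact (closure {m | m ∈ M.carrier ∧ M.bracket m ≤ R}) :=
  (hM.totallyBounded_sublevel R).closure.isCompact_of_isClosed isClosed_closure

theorem CompactlyEmbedded.exists_norm_le (hM : M.CompactlyEmbedded) :
    ∃ C : ℝ, 0 ≤ C ∧ ∀ u ∈ M.carrier, ‖u‖ ≤ C * M.bracket u := by
  obtain ⟨C, hC⟩ := (hM.totallyBounded_sublevel 1).isBounded.exists_norm_le
  refine ⟨max C 0, le_max_right _ _, fun u hu => ?_⟩
  rcases (M.bracket_nonneg u hu).eq_or_lt with h0 | hpos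
  · rw [← h0, (M.bracket_eq_zero_iff u hu).1 h0.symm, norm_zero, mul_zero]
  · have hinv : 0 ≤ (M.bracket u)⁻¹ := (inv_pos.2 hpos).le
    have h1 := hC ((M.bracket u)⁻¹ • u) ⟨M.smul_mem u hu _ hinv, by
      rw [M.bracket_smul u hu _ hinv, inv_mul_cancel₀ hpos.ne']⟩
    rw [norm_smul, Real.norm_of_nonneg hinv, inv_mul_le_iff₀ hpos] at h1
    calc ‖u‖ ≤ M.bracket u * C := h1
      _ ≤ M.bracket u * max C 0 := by gcongr; exact le_max_left _ _
      _ = max C 0 * M.bracket u := mul_comm _ _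

/-- The Ehrling-type interpolation inequality for differences of elements of the cone. It replaces
the embedding `B ↪ Y` and the linearity of `M` in the classical Aubin–Lions lemma. -/
theorem CompactlyEmbedded.exists_interpolation {Y Z : Type*} [NormedAddCommGroup Y]
    [NormedSpace ℝ Y] [AddCommGroup Z] [Module ℝ Z] {jB : B →ₗ[ℝ] Z} {jY : Y →ₗ[ℝ] Z}
    (hM : M.CompactlyEmbedded) (hjY : Function.Injective jY) (hc : LimitsCompatible jB jY)
    {ε : ℝ} (hε : 0 < ε) :
    ∃ K : ℝ, 0 ≤ K ∧ ∀ u ∈ M.carrier, ∀ v ∈ M.carrier, MemOther jB jY u → MemOther jB jY v →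
      ‖u - v‖ ≤ ε * (M.bracket u + M.bracket v) + K * ‖toOther jB jY (u - v)‖ := by
  by_contra! H
  choose u hu v hv huY hvY huv using fun n : ℕ => H n n.cast_nonneg
  have hu0 n := M.bracket_nonneg _ (hu n)
  have hv0 n := M.bracket_nonneg _ (hv n)
  set s : ℕ → ℝ := fun n => M.bracket (u n) + M.bracket (v n) with hs
  have hspos : ∀ n, 0 < s n := by
    intro n
    refine (add_nonneg (hu0 n) (hv0 n)).lt_of_ne fun h0 => ?_
    have h1 : u n = 0 := (M.bracket_eq_zero_iff _ (hu n)).1 (by linarith [hu0 n, hv0 n])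
    have h2 : v n = 0 := (M.bracket_eq_zero_iff _ (hv n)).1 (by linarith [hu0 n, hv0 n])
    have h3 := huv n
    rw [← h0, h1, h2, sub_zero, norm_zero] at h3
    exact absurd h3 (not_lt.2 (by positivity))
  have hinv n : 0 ≤ (s n)⁻¹ := (inv_pos.2 (hspos n)).le
  -- Both normalised sequences stay in the sublevel set `{[·] ≤ 1}`.
  have hale n : M.bracket ((s n)⁻¹ • u n) ≤ 1 := by
    rw [M.bracket_smul _ (hu n) _ (hinv n), inv_mul_le_iff₀ (hspos n), mul_one]
    exact le_add_of_nonneg_right (hv0 n)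
  have hble n : M.bracket ((s n)⁻¹ • v n) ≤ 1 := by
    rw [M.bracket_smul _ (hv n) _ (hinv n), inv_mul_le_iff₀ (hspos n), mul_one]
    exact le_add_of_nonneg_left (hu0 n)
  have haM n := M.smul_mem _ (hu n) _ (hinv n)
  have hbM n := M.smul_mem _ (hv n) _ (hinv n)
  obtain ⟨a, φ, hφ, ha⟩ := hM _ haM ⟨1, hale⟩
  obtain ⟨b, ψ, hψ, hb⟩ := hM _ (fun n => hbM (φ n)) ⟨1, fun n => hble (φ n)⟩
  set w : ℕ → B := fun n => (s n)⁻¹ • (u n - v n) with hw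
  have hwY n : MemOther jB jY (w n) := ((huY n).sub (hvY n)).smul _
  have hlim : Tendsto (fun n => w (φ (ψ n))) atTop (𝓝 (a - b)) := by
    simpa only [hw, smul_sub, Function.comp_def] using (ha.comp hψ.tendsto_atTop).sub hb
  have hlow n : ε + n * ‖toOther jB jY (w n)‖ < ‖w n‖ := by
    rw [hw]
    simp only
    rw [toOther_smul hjY _ ((huY n).sub (hvY n)), norm_smul, norm_smul,
      Real.norm_of_nonneg (hinv n), ← mul_lt_mul_iff_right₀ (hspos n),
      mul_inv_cancel_left₀ (hspos n).ne']
    calc s n * (ε + n * ((s n)⁻¹ * ‖toOther jB jY (u n - v n)‖))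
        = ε * s n + n * ‖toOther jB jY (u n - v n)‖ := by
          field_simp [(hspos n).ne']
      _ < _ := huv n
  obtain ⟨C, hC⟩ := hlim.norm.bddAbove_range
  have hY : Tendsto (fun n => toOther jB jY (w (φ (ψ n)))) atTop (𝓝 0) := by
    have hφψ : Tendsto (fun n => ((φ (ψ n) : ℕ) : ℝ)) atTop atTop :=
      tendsto_natCast_atTop_atTop.comp (hφ.comp hψ).tendsto_atTop
    refine squeeze_zero_norm' ?_ (tendsto_const_nhds.div_atTop hφψ : Tendsto (fun n => C / _) _ _)
    filter_upwards [hφψ.eventually_gt_atTop 0] with n hn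
    rw [le_div_iff₀' hn]
    have := hlow (φ (ψ n))
    have : ‖w (φ (ψ n))‖ ≤ C := hC (mem_range_self n)
    linarith
  have h0 := hc _ _ (fun n => hwY _) hlim hY
  rw [h0] at hlim
  have : ε ≤ ‖(0 : B)‖ := ge_of_tendsto' hlim.norm fun n => by
    have := hlow (φ (ψ n))
    have : 0 ≤ (φ (ψ n) : ℝ) * ‖toOther jB jY (w (φ (ψ n)))‖ := by positivity
    linarith
  rw [norm_zero] at this
  linarith

end SeminormedNonnegCone

/-! ### Time shifts: from `Y`-valued to `B`-valued estimates -/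

theorem measurePreserving_add_timeMeasure (T h : ℝ) :
    MeasurePreserving (fun t : ℝ => t + h) (timeMeasure (T - h)) (volume.restrict (Ioo h T)) := by
  have := (measurePreserving_add_right (volume : Measure ℝ) h).restrict_preimage
    (measurableSet_Ioo (a := h) (b := T))
  simpa using this

theorem restrict_Ioo_le_timeMeasure {T h : ℝ} (hh : 0 ≤ h) :
    volume.restrict (Ioo h T) ≤ timeMeasure T :=
  Measure.restrict_mono (Ioo_subset_Ioo_left hh) le_rfl

theorem timeMeasure_sub_le {T h : ℝ} (hh : 0 ≤ h) : timeMeasure (T - h) ≤ timeMeasure T :=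
  Measure.restrict_mono (Ioo_subset_Ioo_right (by linarith)) le_rfl

theorem quasiMeasurePreserving_add_timeMeasure {T h : ℝ} (hh : 0 ≤ h) :
    Measure.QuasiMeasurePreserving (fun t : ℝ => t + h) (timeMeasure (T - h)) (timeMeasure T) :=
  (measurePreserving_add_timeMeasure T h).quasiMeasurePreserving.mono_right
    (restrict_Ioo_le_timeMeasure hh).absolutelyContinuous

theorem eLpNorm_comp_add_timeMeasure_le {E : Type*} [NormedAddCommGroup E] {T h : ℝ} (hh : 0 ≤ h)
    {f : ℝ → E} (hf : AEStronglyMeasurable f (timeMeasure T)) (p : ℝ≥0∞) :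
    eLpNorm (fun t => f (t + h)) p (timeMeasure (T - h)) ≤ eLpNorm f p (timeMeasure T) :=
  (eLpNorm_comp_measurePreserving (hf.mono_measure (restrict_Ioo_le_timeMeasure hh))
    (measurePreserving_add_timeMeasure T h)).trans_le
    (eLpNorm_mono_measure f (restrict_Ioo_le_timeMeasure hh))

section TimeSpaces

variable {B Y Z : Type*}
  [NormedAddCommGroup B] [NormedSpace ℝ B] [NormedAddCommGroup Y] [NormedSpace ℝ Y]
  [AddCommGroup Z] [Module ℝ Z] {jB : B →ₗ[ℝ] Z} {jY : Y →ₗ[ℝ] Z} {M : SeminormedNonnegCone B}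
  {p : ℝ≥0∞} {T : ℝ}

/-- `‖σ_h u - u‖_{L^p(0,T-h;B)} → 0` as `h → 0⁺`, uniformly in `u ∈ U`: the analogue of
`TimeShiftsVanish` with values in `B`. -/
def UniformShiftContinuity (p : ℝ≥0∞) (T : ℝ) (U : Set (ℝ →ₘ[timeMeasure T] B)) : Prop :=
  ∀ ε : ℝ, 0 < ε → ∃ δ : ℝ, 0 < δ ∧ ∀ h : ℝ, 0 < h → h < δ → ∀ u ∈ U,
    eLpNorm (fun t => u (t + h) - u t) p (timeMeasure (T - h)) ≤ ENNReal.ofReal ε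

theorem MemLpConeInter.memLp (hM : M.CompactlyEmbedded) {u : ℝ →ₘ[timeMeasure T] B}
    (hu : MemLpConeInter M jB jY p T u) : MemLp u p (timeMeasure T) := by
  obtain ⟨C, -, hC⟩ := hM.exists_norm_le
  refine hu.2.2.of_le_mul u.aestronglyMeasurable (c := C) ?_
  filter_upwards [hu.1] with t ht
  rw [Real.norm_of_nonneg (M.bracket_nonneg _ ht.1)]
  exact hC _ ht.1

/-- The interpolation inequality turns shift continuity with values in `Y` into shift continuity
with values in `B`. -/
theorem uniformShiftContinuity_of_timeShiftsVanish (hp : 1 ≤ p) (hjY : Function.Injective jY)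
    (hM : M.CompactlyEmbedded) (hc : LimitsCompatible jB jY) {U : Set (ℝ →ₘ[timeMeasure T] B)}
    (h_mem : ∀ u ∈ U, MemLpConeInter M jB jY p T u) (h_bdd : BoundedInLpCone M p T U)
    (h_shift : TimeShiftsVanish jB jY p T U) : UniformShiftContinuity p T U := by
  obtain ⟨C, hC⟩ := h_bdd
  intro ε hε
  -- The bound `C` may be negative when `U` is empty.
  set C' := max C 0 with hC'
  have hC0 : 0 ≤ C' := le_max_right _ _
  set ε₁ := ε / (4 * (C' + 1)) with hε₁
  have hε₁pos : 0 < ε₁ := by positivity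
  obtain ⟨K, hK, hint⟩ := hM.exists_interpolation hjY hc hε₁pos
  set ε₂ := ε / (2 * (K + 1)) with hε₂
  obtain ⟨δ, hδ, hsh⟩ := h_shift ε₂ (by positivity)
  refine ⟨δ, hδ, fun h hh hhδ u hu => ?_⟩
  have hmem := h_mem u hu
  have hae := hmem.1.filter_mono (ae_mono (timeMeasure_sub_le hh.le))
  have hae' := (quasiMeasurePreserving_add_timeMeasure hh.le).ae hmem.1
  set b : ℝ → ℝ := fun t => M.bracket (u t) with hb
  set y : ℝ → Y := fun t => toOther jB jY (u (t + h) - u t) with hy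
  have hbm : AEStronglyMeasurable b (timeMeasure T) := hmem.2.2.1
  have hb1 : AEStronglyMeasurable b (timeMeasure (T - h)) :=
    hbm.mono_measure (timeMeasure_sub_le hh.le)
  have hb2 : AEStronglyMeasurable (fun t => b (t + h)) (timeMeasure (T - h)) :=
    hbm.comp_quasiMeasurePreserving (quasiMeasurePreserving_add_timeMeasure hh.le)
  have hym : AEStronglyMeasurable y (timeMeasure (T - h)) := by
    refine ((hmem.2.1.comp_quasiMeasurePreserving
      (quasiMeasurePreserving_add_timeMeasure hh.le)).sub
      (hmem.2.1.mono_measure (timeMeasure_sub_le hh.le))).congr ?_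
    filter_upwards [hae, hae'] with t ht ht'
    exact (toOther_sub hjY ht'.2 ht.2).symm
  have hbC : eLpNorm b p (timeMeasure T) ≤ ENNReal.ofReal C' :=
    (hC u hu).trans (ENNReal.ofReal_le_ofReal (le_max_left _ _))
  have e1 : eLpNorm (ε₁ • ((fun t => b (t + h)) + b)) p (timeMeasure (T - h))
      ≤ ENNReal.ofReal (ε / 2) := by
    calc _ = ENNReal.ofReal ε₁ * eLpNorm ((fun t => b (t + h)) + b) p (timeMeasure (T - h)) := by
          rw [eLpNorm_const_smul, Real.enorm_of_nonneg hε₁pos.le]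
      _ ≤ ENNReal.ofReal ε₁ * (ENNReal.ofReal C' + ENNReal.ofReal C') := by
          gcongr
          exact (eLpNorm_add_le hb2 hb1 hp).trans (add_le_add
            ((eLpNorm_comp_add_timeMeasure_le hh.le hbm p).trans hbC)
            ((eLpNorm_mono_measure b (timeMeasure_sub_le hh.le)).trans hbC))
      _ = ENNReal.ofReal (ε₁ * (C' + C')) := by
          rw [← ENNReal.ofReal_add hC0 hC0, ← ENNReal.ofReal_mul hε₁pos.le]
      _ ≤ ENNReal.ofReal (ε / 2) := by
          apply ENNReal.ofReal_le_ofReal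
          rw [hε₁, div_mul_eq_mul_div, div_le_div_iff₀ (by positivity) (by positivity)]
          nlinarith
  have e2 : eLpNorm (K • fun t => ‖y t‖) p (timeMeasure (T - h)) ≤ ENNReal.ofReal (ε / 2) := by
    calc _ = ENNReal.ofReal K * eLpNorm y p (timeMeasure (T - h)) := by
          rw [eLpNorm_const_smul, Real.enorm_of_nonneg hK, eLpNorm_norm]
      _ ≤ ENNReal.ofReal K * ENNReal.ofReal ε₂ := by
          gcongr
          exact hsh h hh hhδ u hu
      _ = ENNReal.ofReal (K * ε₂) := (ENNReal.ofReal_mul hK).symm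
      _ ≤ ENNReal.ofReal (ε / 2) := by
          apply ENNReal.ofReal_le_ofReal
          rw [hε₂, mul_div_assoc', div_le_div_iff₀ (by positivity) (by positivity)]
          nlinarith
  calc eLpNorm (fun t => u (t + h) - u t) p (timeMeasure (T - h))
      ≤ eLpNorm (ε₁ • ((fun t => b (t + h)) + b) + K • fun t => ‖y t‖) p (timeMeasure (T - h)) := by
        refine eLpNorm_mono_ae_real ?_
        filter_upwards [hae, hae'] with t ht ht'
        simpa only [Pi.add_apply, Pi.smul_apply, smul_eq_mul] using hint _ ht'.1 _ ht.1 ht'.2 ht.2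
    _ ≤ ENNReal.ofReal (ε / 2) + ENNReal.ofReal (ε / 2) :=
        (eLpNorm_add_le ((hb2.add hb1).const_smul ε₁) (hym.norm.const_smul K) hp).trans
          (add_le_add e1 e2)
    _ = ENNReal.ofReal ε := by
        rw [← ENNReal.ofReal_add (by positivity) (by positivity), add_halves]

end TimeSpaces

/-! ### Double integrals near the diagonal, and sampling -/

/-- Fubini near the diagonal: if every slice `t ↦ F t (t + τ)` with `|τ| < h` has integral at most
`c`, then the integral of `F` over the strip `|r - t| < h` is at most `2 h c`. -/
theorem lintegral_lintegral_near_diagonal_le {F : ℝ → ℝ → ℝ≥0∞}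
    (hF : Measurable (Function.uncurry F)) {h : ℝ} {c : ℝ≥0∞}
    (H : ∀ τ, |τ| < h → ∫⁻ t, F t (t + τ) ≤ c) :
    ∫⁻ t, ∫⁻ r in Ioo (t - h) (t + h), F t r ≤ ENNReal.ofReal (2 * h) * c := by
  have hinner : ∀ t, ∫⁻ r in Ioo (t - h) (t + h), F t r = ∫⁻ τ in Ioo (-h) h, F t (t + τ) := by
    intro t
    rw [← (measurePreserving_add_left (volume : Measure ℝ) t).setLIntegral_comp_preimage
      measurableSet_Ioo hF.of_uncurry_left]
    congr 2
    ext τ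
    simp only [mem_preimage, mem_Ioo]
    constructor <;> rintro ⟨h1, h2⟩ <;> constructor <;> linarith
  simp_rw [hinner]
  rw [lintegral_lintegral_swap]
  · calc ∫⁻ τ in Ioo (-h) h, ∫⁻ t, F t (t + τ) ≤ ∫⁻ _ in Ioo (-h) h, c :=
          setLIntegral_mono measurable_const fun τ hτ => H τ (abs_lt.2 hτ)
      _ = ENNReal.ofReal (2 * h) * c := by
          rw [setLIntegral_const, Real.volume_Ioo, mul_comm, sub_neg_eq_add, two_mul]
  · exact (hF.comp (measurable_fst.prodMk (measurable_fst.add measurable_snd))).aemeasurable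

/-- Bounds on the positive time shifts of `u` on `(0, T)` control the double integral of a function
of the increments of `u` near the diagonal. Negative shifts reduce to positive ones by symmetry. -/
theorem lintegral_lintegral_increment_le {B : Type*} [NormedAddCommGroup B] {u : ℝ → B}
    (hu : StronglyMeasurable u) {ψ : ℝ≥0∞ → ℝ≥0∞} (hψ : Measurable ψ) (hψ0 : ψ 0 = 0)
    {T h : ℝ} {c : ℝ≥0∞}
    (H : ∀ τ, 0 < τ → τ < h → ∫⁻ t, ψ ‖u (t + τ) - u t‖ₑ ∂timeMeasure (T - τ) ≤ c) :
    ∫⁻ t, ∫⁻ r in Ioo (t - h) (t + h), ψ ‖u r - u t‖ₑ ∂timeMeasure T ∂timeMeasure T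
      ≤ ENNReal.ofReal (2 * h) * c := by
  set I := Ioo 0 T with hI
  have hIm : MeasurableSet I := measurableSet_Ioo
  set G : ℝ × ℝ → ℝ≥0∞ := fun x => ψ ‖u x.2 - u x.1‖ₑ with hG
  have hGm : Measurable G := hψ.comp
    ((hu.comp_measurable measurable_snd).sub (hu.comp_measurable measurable_fst)).enorm
  set F : ℝ → ℝ → ℝ≥0∞ := fun t r => (I ×ˢ I).indicator G (t, r) with hF
  have hFm : Measurable (Function.uncurry F) := hGm.indicator (hIm.prod hIm)
  have hsymm : ∀ t r, F t r = F r t := by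
    intro t r
    simp only [hF, indicator, mem_prod, hG, and_comm, enorm_sub_rev]
  have hpos : ∀ τ, 0 < τ → τ < h → ∫⁻ t, F t (t + τ) ≤ c := by
    intro τ hτ hτh
    refine le_trans (le_of_eq ?_) (H τ hτ hτh)
    rw [← lintegral_indicator measurableSet_Ioo]
    congr 1
    ext t
    simp only [hF, indicator, mem_prod, hI, mem_Ioo, hG]
    congr 1
    refine propext ⟨fun h => ⟨h.1.1, ?_⟩, fun h => ⟨⟨h.1, ?_⟩, ?_, ?_⟩⟩ <;> linarith [h.1, h.2]
  have key := lintegral_lintegral_near_diagonal_le hFm (h := h) (c := c) fun τ hτ => by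
    rcases lt_trichotomy τ 0 with h0 | rfl | h0
    · rw [abs_of_neg h0] at hτ
      refine le_trans (le_of_eq ?_) (hpos (-τ) (by linarith) hτ)
      rw [← lintegral_add_right_eq_self (fun t => F t (t + -τ)) τ]
      congr 1
      ext t
      rw [hsymm, add_neg_cancel_right]
    · simp [hF, hG, indicator, hψ0]
    · exact hpos τ h0 (by rwa [abs_of_pos h0] at hτ)
  refine le_trans (le_of_eq ?_) key
  rw [← lintegral_indicator hIm]
  congr 1
  ext t
  by_cases ht : t ∈ I
  · rw [indicator_of_mem ht, Measure.restrict_restrict measurableSet_Ioo, inter_comm,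
      ← Measure.restrict_restrict hIm,
      ← lintegral_indicator hIm]
    congr 1
    ext r
    simp [hF, hG, indicator, ht]
  · simp [hF, indicator, ht]

/-- On a set of finite positive measure, some point satisfies a given almost sure property and is
one where `F` does not exceed its average. -/
theorem exists_mem_measure_mul_le_setLIntegral {α : Type*} [MeasurableSpace α] {μ : Measure α}
    {A : Set α} (hA : MeasurableSet A) (h0 : μ A ≠ 0) (htop : μ A ≠ ∞) {F : α → ℝ≥0∞}
    (hF : AEMeasurable F (μ.restrict A)) {P : α → Prop} (hP : ∀ᵐ x ∂μ, P x) :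
    ∃ x ∈ A, P x ∧ μ A * F x ≤ ∫⁻ a in A, F a ∂μ := by
  have hae : ∀ᵐ x ∂μ.restrict A, x ∈ A ∧ P x :=
    (ae_restrict_mem hA).and (ae_restrict_of_ae hP)
  have : IsFiniteMeasure (μ.restrict A) := ⟨by simpa using htop.lt_top⟩
  obtain ⟨x, hx, hxF⟩ := exists_notMem_null_le_laverage
    (by rwa [Ne, Measure.restrict_eq_zero]) hF (ae_iff.1 hae)
  obtain ⟨hxA, hxP⟩ := not_not.1 hx
  refine ⟨x, hxA, hxP, ?_⟩
  rwa [setLAverage_eq, ENNReal.le_div_iff_mul_le (Or.inl h0) (Or.inl htop), mul_comm] at hxF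

/-! ### Continuous representatives and the case `p = ∞` -/

section Representatives

variable {B : Type*} [NormedAddCommGroup B] {T : ℝ}

theorem ae_ae_enorm_sub_le {u : ℝ → B} (hu : StronglyMeasurable u) {h : ℝ} {c : ℝ≥0∞}
    (H : ∀ τ, 0 < τ → τ < h →
      eLpNorm (fun t => u (t + τ) - u t) ∞ (timeMeasure (T - τ)) ≤ c) :
    ∀ᵐ t ∂timeMeasure T, ∀ᵐ r ∂timeMeasure T, |r - t| < h → ‖u r - u t‖ₑ ≤ c := by
  set ψ : ℝ≥0∞ → ℝ≥0∞ := (Ioi c).indicator 1 with hψ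
  have hψm : Measurable ψ := measurable_one.indicator measurableSet_Ioi
  have key := lintegral_lintegral_increment_le hu hψm (by simp [hψ]) (c := 0)
    (T := T) (h := h) fun τ h0 hτ => by
      have h1 : ∀ᵐ t ∂timeMeasure (T - τ), ψ ‖u (t + τ) - u t‖ₑ = 0 := by
        filter_upwards [ae_le_eLpNormEssSup (f := fun t => u (t + τ) - u t)] with t ht
        exact indicator_of_notMem (not_lt.2 (ht.trans (by simpa using H τ h0 hτ))) _
      rw [lintegral_congr_ae h1, lintegral_zero]
  -- The strip around the diagonal is moved into the integrand, to have a measurable inner integral.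
  set S : Set (ℝ × ℝ) := {x | |x.2 - x.1| < h} with hS
  have hSm : MeasurableSet S :=
    measurableSet_lt (measurable_snd.sub measurable_fst).abs measurable_const
  set G : ℝ × ℝ → ℝ≥0∞ := S.indicator fun x => ψ ‖u x.2 - u x.1‖ₑ with hG
  have hGm : Measurable G := (hψm.comp ((hu.comp_measurable measurable_snd).sub
    (hu.comp_measurable measurable_fst)).enorm).indicator hSm
  have hGint : ∀ t, ∫⁻ r in Ioo (t - h) (t + h), ψ ‖u r - u t‖ₑ ∂timeMeasure T
      = ∫⁻ r, G (t, r) ∂timeMeasure T := by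
    intro t
    rw [← lintegral_indicator measurableSet_Ioo]
    congr 1
    ext r
    have : r ∈ Ioo (t - h) (t + h) ↔ (t, r) ∈ S := by
      simp only [hS, mem_Ioo, mem_ofPred_eq, abs_lt]
      constructor <;> rintro ⟨h1, h2⟩ <;> constructor <;> linarith
    simp only [hG, indicator, this]
  simp_rw [hGint] at key
  rw [mul_zero, nonpos_iff_eq_zero, lintegral_eq_zero_iff hGm.lintegral_prod_right'] at key
  filter_upwards [key] with t ht
  have hGt : Measurable fun r => G (t, r) := hGm.comp measurable_prodMk_left
  rw [Pi.zero_apply, lintegral_eq_zero_iff hGt] at ht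
  filter_upwards [ht] with r hr hrt
  by_contra! hlt
  have hmem : (t, r) ∈ S := hrt
  simp [hG, hψ, hmem, hlt] at hr

/-- A pointwise version of `ae_ae_enorm_sub_le`: two points of the full-measure set at
distance less than `h` are compared through a common nearby time `r`. -/
theorem norm_sub_le_of_ae {u : ℝ → B} {h ε : ℝ} (hε : 0 ≤ ε) {t s : ℝ} (ht : t ∈ Ioo 0 T)
    (hts : |t - s| < h)
    (Ht : ∀ᵐ r ∂timeMeasure T, |r - t| < h → ‖u r - u t‖ₑ ≤ ENNReal.ofReal ε)
    (Hs : ∀ᵐ r ∂timeMeasure T, |r - s| < h → ‖u r - u s‖ₑ ≤ ENNReal.ofReal ε) :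
    ‖u t - u s‖ ≤ 2 * ε := by
  have hD := Measure.dense_of_ae ((ae_restrict_iff' measurableSet_Ioo).1 (Ht.and Hs))
  obtain ⟨r, hr, ⟨hrI, hrt⟩, hrs⟩ := hD.exists_mem_open
    ((isOpen_Ioo (a := (0 : ℝ)) (b := T)).inter (Metric.isOpen_ball (x := t) (ε := h)) |>.inter
      (Metric.isOpen_ball (x := s) (ε := h)))
    ⟨t, ⟨ht, Metric.mem_ball_self ((abs_nonneg _).trans_lt hts)⟩, hts⟩
  obtain ⟨h1, h2⟩ := hr hrI
  have h1 := h1 hrt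
  have h2 := h2 hrs
  rw [← ofReal_norm, ENNReal.ofReal_le_ofReal_iff hε] at h1 h2
  calc ‖u t - u s‖ = ‖(u r - u s) - (u r - u t)‖ := by rw [sub_sub_sub_cancel_left]
    _ ≤ ‖u r - u s‖ + ‖u r - u t‖ := norm_sub_le _ _
    _ ≤ 2 * ε := by linarith

theorem dense_Icc_of_ae (hT : 0 < T) {P : ℝ → Prop} (hP : ∀ᵐ t ∂timeMeasure T, P t) :
    Dense {x : Icc (0 : ℝ) T | (x : ℝ) ∈ Ioo 0 T ∧ P x} := by
  have hD := Measure.dense_of_ae ((ae_restrict_iff' measurableSet_Ioo).1 hP)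
  have hsub := hD.open_subset_closure_inter (isOpen_Ioo (a := (0 : ℝ)) (b := T))
  intro x
  have hx : (x : ℝ) ∈ closure (Ioo 0 T) := by
    rw [closure_Ioo hT.ne]
    exact x.2
  rw [closure_subtype]
  refine closure_mono ?_ (closure_minimal hsub isClosed_closure hx)
  rintro y ⟨hyI, hy⟩
  exact ⟨⟨y, Ioo_subset_Icc_self hyI⟩, ⟨hyI, hy hyI⟩, rfl⟩

/-- A continuous representative inherits its modulus of continuity from the shift estimates in
`L^∞`; the factor `2` comes from comparing two times through a third one. -/
theorem RepresentedBy.dist_le (hT : 0 < T) {u : ℝ →ₘ[timeMeasure T] B} {g : C(Icc (0 : ℝ) T, B)}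
    (hg : RepresentedBy T u g) {h ε : ℝ} (hε : 0 ≤ ε)
    (H : ∀ τ, 0 < τ → τ < h → eLpNorm (fun t => u (t + τ) - u t) ∞ (timeMeasure (T - τ))
      ≤ ENNReal.ofReal ε) {x y : Icc (0 : ℝ) T} (hxy : dist x y < h) :
    dist (g x) (g y) ≤ 2 * ε := by
  have hD := dense_Icc_of_ae hT ((ae_ae_enorm_sub_le u.stronglyMeasurable H).and hg)
  have hV : IsOpen {z : Icc (0 : ℝ) T × Icc (0 : ℝ) T | dist z.1 z.2 < h} :=
    isOpen_lt (by fun_prop) continuous_const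
  have hC : IsClosed {z : Icc (0 : ℝ) T × Icc (0 : ℝ) T | dist (g z.1) (g z.2) ≤ 2 * ε} :=
    isClosed_le (by fun_prop) continuous_const
  refine closure_minimal ?_ hC
    ((hD.prod hD).open_subset_closure_inter hV (show (x, y) ∈ _ from hxy))
  rintro ⟨a, b⟩ ⟨hab, ⟨haI, ha, hag⟩, ⟨-, hb, hbg⟩⟩
  have := norm_sub_le_of_ae hε haI hab ha hb
  rwa [hag a.2, hbg b.2, ← dist_eq_norm] at this

theorem RepresentedBy.apply_mem_closure (hT : 0 < T) {u : ℝ →ₘ[timeMeasure T] B}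
    {g : C(Icc (0 : ℝ) T, B)} (hg : RepresentedBy T u g) {K : Set B}
    (hK : ∀ᵐ t ∂timeMeasure T, u t ∈ K) (x : Icc (0 : ℝ) T) : g x ∈ closure K := by
  refine closure_minimal ?_ (isClosed_closure.preimage g.continuous)
    (dense_Icc_of_ae hT (hK.and hg) x)
  rintro y ⟨-, hyK, hy⟩
  have : g y = u y := (hy y.2).symm
  exact subset_closure (by rwa [this])

theorem exists_representedBy [CompleteSpace B] (hT : 0 < T) {u : ℝ →ₘ[timeMeasure T] B}
    (H : ∀ ε : ℝ, 0 < ε → ∃ δ : ℝ, 0 < δ ∧ ∀ τ : ℝ, 0 < τ → τ < δ →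
      eLpNorm (fun t => u (t + τ) - u t) ∞ (timeMeasure (T - τ)) ≤ ENNReal.ofReal ε) :
    ∃ g : C(Icc (0 : ℝ) T, B), RepresentedBy T u g := by
  choose δ hδ Hδ using fun n : ℕ => H (1 / ((n : ℝ) + 1)) (by positivity)
  have hae := ae_all_iff.2 fun n => ae_ae_enorm_sub_le u.stronglyMeasurable (Hδ n)
  set D : Set (Icc (0 : ℝ) T) := {x | (x : ℝ) ∈ Ioo 0 T ∧ ∀ n, ∀ᵐ r ∂timeMeasure T,
    |r - (x : ℝ)| < δ n → ‖u r - u x‖ₑ ≤ ENNReal.ofReal (1 / ((n : ℝ) + 1))} with hDdef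
  have hD : Dense D := dense_Icc_of_ae hT hae
  have hf : UniformContinuous fun x : D => u (x : Icc (0 : ℝ) T) := by
    rw [Metric.uniformContinuous_iff]
    intro ε hε
    obtain ⟨n, hn⟩ := exists_nat_one_div_lt (half_pos hε)
    refine ⟨δ n, hδ n, fun {x y} hxy => ?_⟩
    rw [dist_eq_norm]
    have := norm_sub_le_of_ae (by positivity) x.2.1 hxy (x.2.2 n) (y.2.2 n)
    linarith
  refine ⟨⟨_, (uniformContinuous_uniformly_extend (isUniformInducing_val D) hD.denseRange_val
    hf).continuous⟩, ?_⟩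
  filter_upwards [hae, ae_restrict_mem measurableSet_Ioo] with t ht htI htT
  exact (uniformly_extend_of_ind (isUniformInducing_val D) hD.denseRange_val hf
    ⟨⟨t, htT⟩, htI, ht⟩).symm

/-- Arzelà–Ascoli for the continuous representatives. -/
theorem isCompact_closure_representatives (hT : 0 < T) {U : Set (ℝ →ₘ[timeMeasure T] B)}
    (hU : UniformShiftContinuity ∞ T U) {K : Set B} (hK : IsCompact (closure K))
    (hUK : ∀ u ∈ U, ∀ᵐ t ∂timeMeasure T, u t ∈ K) :
    IsCompact (closure {g : C(Icc (0 : ℝ) T, B) | ∃ u ∈ U, RepresentedBy T u g}) := by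
  set A := {g : C(Icc (0 : ℝ) T, B) | ∃ u ∈ U, RepresentedBy T u g} with hA
  set e := ContinuousMap.isometryEquivBoundedOfCompact (Icc (0 : ℝ) T) B with he
  have hAA : IsCompact (closure (e '' A)) := by
    refine BoundedContinuousFunction.arzela_ascoli _ hK _ ?_ ?_
    · rintro _ x ⟨g, ⟨u, hu, hg⟩, rfl⟩
      exact hg.apply_mem_closure hT (hUK u hu) x
    · refine UniformEquicontinuous.equicontinuous (Metric.uniformEquicontinuous_iff.2 ?_)
      intro ε hε
      obtain ⟨δ, hδ, Hδ⟩ := hU (ε / 3) (by positivity)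
      refine ⟨δ, hδ, ?_⟩
      rintro x y hxy ⟨_, g, ⟨u, hu, hg⟩, rfl⟩
      have : dist (g x) (g y) ≤ 2 * (ε / 3) :=
        hg.dist_le hT (by positivity) (fun τ h0 hτ => Hδ τ h0 hτ u hu) hxy
      exact this.trans_lt (by linarith)
  have himage : closure (e '' A) = e '' closure A := (e.toHomeomorph.image_closure A).symm
  rw [himage] at hAA
  exact e.toHomeomorph.isCompact_image.1 hAA

/-- Compactness of the continuous representatives in the uniform norm implies compactness of the
classes in `L^∞`. -/
theorem isCompact_closure_Lp_top (hT : 0 < T) {U : Set (ℝ →ₘ[timeMeasure T] B)}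
    (hrep : ∀ u ∈ U, ∃ g : C(Icc (0 : ℝ) T, B), RepresentedBy T u g)
    (hcpt : IsCompact (closure {g : C(Icc (0 : ℝ) T, B) | ∃ u ∈ U, RepresentedBy T u g})) :
    IsCompact (closure {f : Lp B ∞ (timeMeasure T) | (f : ℝ →ₘ[timeMeasure T] B) ∈ U}) := by
  have hmem : ∀ g : C(Icc (0 : ℝ) T, B),
      MemLp (fun t => g (projIcc 0 T hT.le t)) ∞ (timeMeasure T) := fun g =>
    memLp_top_of_bound (g.continuous.comp continuous_projIcc).aestronglyMeasurable ‖g‖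
      (Eventually.of_forall fun t => g.norm_coe_le_norm _)
  have hcont : Continuous fun g => (hmem g).toLp := by
    refine (LipschitzWith.of_edist_le fun g g' => ?_).continuous
    rw [Lp.edist_toLp_toLp, eLpNorm_exponent_top]
    refine essSup_le_of_ae_le _ (Eventually.of_forall fun t => ?_)
    simp only [Pi.sub_apply]
    rw [← edist_eq_enorm_sub, edist_dist, edist_dist]
    exact ENNReal.ofReal_le_ofReal (ContinuousMap.dist_apply_le_dist _)
  have himage := hcpt.image hcont
  refine himage.of_isClosed_subset isClosed_closure (closure_minimal ?_ himage.isClosed)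
  intro f hf
  obtain ⟨g, hg⟩ := hrep _ hf
  refine ⟨g, subset_closure ⟨_, hf, hg⟩, Lp.ext ((hmem g).coeFn_toLp.trans ?_)⟩
  filter_upwards [hg, ae_restrict_mem measurableSet_Ioo] with t ht htI
  rw [ht (Ioo_subset_Icc_self htI), projIcc_of_mem _ (Ioo_subset_Icc_self htI)]

end Representatives

/-! ### Step functions on a grid and the case `p < ∞` -/

/-- The `k`-th of the consecutive half-open intervals of length `h` to the right of `0`. -/
def gridCell (h : ℝ) (k : ℕ) : Set ℝ := Ioc (k * h) ((k + 1) * h)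

section GridCell

variable {T h : ℝ} {N : ℕ}

theorem measurableSet_gridCell (h : ℝ) (k : ℕ) : MeasurableSet (gridCell h k) := measurableSet_Ioc

theorem pairwise_disjoint_gridCell (hh : 0 ≤ h) :
    Pairwise (Function.onFun Disjoint fun k : Fin N => gridCell h k) := by
  have hmono : Monotone fun k : ℕ => (k : ℝ) * h := fun a b hab => by
    have : (a : ℝ) ≤ b := by exact_mod_cast hab
    exact mul_le_mul_of_nonneg_right this hh
  intro i j hij
  simpa [Function.onFun, gridCell] using
    hmono.pairwise_disjoint_on_Ioc_succ (Fin.val_ne_of_ne hij)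

theorem iUnion_gridCell (hh : 0 ≤ h) (hN : N * h = T) :
    ⋃ k ∈ (Finset.univ : Finset (Fin N)), gridCell h k = Ioc 0 T := by
  have hmono : Monotone fun k : ℕ => (k : ℝ) * h := fun a b hab => by
    have : (a : ℝ) ≤ b := by exact_mod_cast hab
    exact mul_le_mul_of_nonneg_right this hh
  have := hmono.biUnion_Ico_Ioc_map_succ 0 N
  rw [Nat.cast_zero, zero_mul, hN] at this
  rw [← this]
  ext t
  simp [gridCell, Fin.exists_iff]

theorem timeMeasure_gridCell (hh : 0 ≤ h) (hN : N * h = T) (k : Fin N) :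
    timeMeasure T (gridCell h k) = ENNReal.ofReal h := by
  have hsub : gridCell h k ⊆ Ioc 0 T := by
    rw [← iUnion_gridCell hh hN]
    exact subset_biUnion_of_mem (u := fun k : Fin N => gridCell h k) (Finset.mem_univ k)
  rw [timeMeasure, restrict_Ioo_eq_restrict_Ioc, Measure.restrict_apply (measurableSet_gridCell h k),
    inter_eq_left.2 hsub, gridCell, Real.volume_Ioc]
  congr 1
  ring

theorem lintegral_timeMeasure_eq_sum_gridCell (hh : 0 ≤ h) (hN : N * h = T) (f : ℝ → ℝ≥0∞) :
    ∫⁻ t, f t ∂timeMeasure T = ∑ k : Fin N, ∫⁻ t in gridCell h k, f t ∂timeMeasure T := by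
  rw [← lintegral_biUnion_finset (fun i _ j _ hij => pairwise_disjoint_gridCell hh hij)
    (fun k _ => measurableSet_gridCell h k), iUnion_gridCell hh hN, timeMeasure,
    restrict_Ioo_eq_restrict_Ioc, Measure.restrict_restrict measurableSet_Ioc, inter_self]

/-- One sampling time in each cell, such that the piecewise constant function taking the sampled
values is close to `u`, while the sampled values have bounded cost `b`. Such times exist because
the average over all choices satisfies the bound. -/
theorem exists_sample_times {B : Type*} [NormedAddCommGroup B] {u : ℝ → B}
    (hu : StronglyMeasurable u) {ψ : ℝ≥0∞ → ℝ≥0∞} (hψ : Measurable ψ) (hψ0 : ψ 0 = 0)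
    {b : ℝ → ℝ≥0∞} (hb : AEMeasurable b (timeMeasure T)) {P : ℝ → Prop}
    (hP : ∀ᵐ t ∂timeMeasure T, P t) (hh : 0 < h) (hN : N * h = T) {c D lam : ℝ≥0∞}
    (hlam : lam ≠ ∞)
    (H : ∀ τ, 0 < τ → τ < h → ∫⁻ t, ψ ‖u (t + τ) - u t‖ₑ ∂timeMeasure (T - τ) ≤ c)
    (hD : ∫⁻ t, b t ∂timeMeasure T ≤ D) :
    ∃ r : Fin N → ℝ, (∀ k, P (r k)) ∧
      ∑ k : Fin N, (∫⁻ t in gridCell h k, ψ ‖u t - u (r k)‖ₑ ∂timeMeasure T + lam * b (r k))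
        ≤ (ENNReal.ofReal (2 * h) * c + lam * D) / ENNReal.ofReal h := by
  set μ := timeMeasure T with hμ
  have hGm : Measurable fun x : ℝ × ℝ => ψ ‖u x.2 - u x.1‖ₑ := hψ.comp
    ((hu.comp_measurable measurable_snd).sub (hu.comp_measurable measurable_fst)).enorm
  have hh0 : ENNReal.ofReal h ≠ 0 := by simpa using hh
  have hsample (k : Fin N) := exists_mem_measure_mul_le_setLIntegral (μ := μ)
    (measurableSet_gridCell h k) (by rwa [timeMeasure_gridCell hh.le hN])
    (by rw [timeMeasure_gridCell hh.le hN]; exact ENNReal.ofReal_ne_top)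
    (F := fun r => ∫⁻ t in gridCell h k, ψ ‖u t - u r‖ₑ ∂μ + lam * b r)
    (hGm.lintegral_prod_right'.aemeasurable.add (hb.restrict.const_mul lam)) hP
  choose r hr hrP hrF using hsample
  refine ⟨r, hrP, ?_⟩
  rw [ENNReal.le_div_iff_mul_le (Or.inl hh0) (Or.inl ENNReal.ofReal_ne_top), mul_comm,
    Finset.mul_sum]
  have hnear : ∀ k : Fin N, ∀ t ∈ gridCell h k, gridCell h k ⊆ Ioo (t - h) (t + h) := by
    intro k t ht s hs
    simp only [gridCell, mem_Ioc] at ht hs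
    constructor <;> linarith [ht.1, ht.2, hs.1, hs.2]
  calc ∑ k : Fin N, ENNReal.ofReal h * (∫⁻ t in gridCell h k, ψ ‖u t - u (r k)‖ₑ ∂μ + lam * b (r k))
      ≤ ∑ k : Fin N, ∫⁻ s in gridCell h k,
          (∫⁻ t in gridCell h k, ψ ‖u t - u s‖ₑ ∂μ + lam * b s) ∂μ :=
        Finset.sum_le_sum fun k _ => by
          have := hrF k
          rwa [timeMeasure_gridCell hh.le hN] at this
    _ ≤ ∑ k : Fin N, ∫⁻ s in gridCell h k,
          (∫⁻ t in Ioo (s - h) (s + h), ψ ‖u t - u s‖ₑ ∂μ + lam * b s) ∂μ :=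
        Finset.sum_le_sum fun k _ => setLIntegral_mono' (measurableSet_gridCell h k) fun s hs => by
          gcongr
          exact hnear k s hs
    _ = ∫⁻ s, (∫⁻ t in Ioo (s - h) (s + h), ψ ‖u t - u s‖ₑ ∂μ + lam * b s) ∂μ :=
        (lintegral_timeMeasure_eq_sum_gridCell hh.le hN _).symm
    _ = ∫⁻ s, ∫⁻ t in Ioo (s - h) (s + h), ψ ‖u t - u s‖ₑ ∂μ ∂μ + lam * ∫⁻ s, b s ∂μ := by
        rw [lintegral_add_right' _ (hb.const_mul lam), lintegral_const_mul' _ _ hlam]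
    _ ≤ ENNReal.ofReal (2 * h) * c + lam * D := by
        gcongr
        exact lintegral_lintegral_increment_le hu hψ hψ0 H

variable {B : Type*} [NormedAddCommGroup B] {p : ℝ≥0∞}

theorem timeMeasure_ne_top (T : ℝ) (s : Set ℝ) : timeMeasure T s ≠ ∞ :=
  measure_ne_top _ _

/-- The class in `L^p(0,T;B)` of the step function with value `x k` on the `k`-th grid cell. -/
noncomputable def gridStep (p : ℝ≥0∞) (T h : ℝ) (x : Fin N → B) : Lp B p (timeMeasure T) :=
  ∑ k : Fin N, indicatorConstLp p (measurableSet_gridCell h k) (timeMeasure_ne_top T _) (x k)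

theorem continuous_gridStep [Fact (1 ≤ p)] :
    Continuous (gridStep p T h : (Fin N → B) → Lp B p (timeMeasure T)) := by
  refine continuous_finsetSum _ fun k _ => ?_
  have : Continuous fun c : B => indicatorConstLp p (measurableSet_gridCell h k)
      (timeMeasure_ne_top T _) c := by
    refine (LipschitzWith.of_dist_le_mul
      (K := ⟨(timeMeasure T).real (gridCell h k) ^ (1 / p.toReal), by positivity⟩)
      fun c c' => ?_).continuous
    rw [dist_eq_norm, dist_eq_norm, indicatorConstLp_sub, mul_comm]
    exact norm_indicatorConstLp_le
  exact this.comp (continuous_apply k)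

theorem coeFn_gridStep (hh : 0 ≤ h) (x : Fin N → B) :
    ∀ᵐ t ∂timeMeasure T, ∀ k : Fin N, t ∈ gridCell h k → gridStep p T h x t = x k := by
  have hsum : ∀ s : Finset (Fin N),
      ⇑(∑ k ∈ s, indicatorConstLp p (measurableSet_gridCell h k) (timeMeasure_ne_top T _) (x k))
        =ᵐ[timeMeasure T] fun t => ∑ k ∈ s, (gridCell h k).indicator (fun _ => x k) t := by
    classical
    intro s
    induction s using Finset.induction_on with
    | empty =>
      simp only [Finset.sum_empty]
      exact Lp.coeFn_zero B p (timeMeasure T)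
    | insert k s hk ih =>
      rw [Finset.sum_insert hk]
      filter_upwards [Lp.coeFn_add (indicatorConstLp p (measurableSet_gridCell h k)
        (timeMeasure_ne_top T _) (x k)) (∑ k ∈ s, indicatorConstLp p (measurableSet_gridCell h k)
        (timeMeasure_ne_top T _) (x k)), ih, indicatorConstLp_coeFn (p := p)
        (hs := measurableSet_gridCell h k) (hμs := timeMeasure_ne_top T _) (c := x k)]
        with t h1 h2 h3
      rw [h1, Pi.add_apply, h2, h3, Finset.sum_insert hk]
  filter_upwards [hsum Finset.univ] with t ht k htk
  rw [gridStep, ht, Finset.sum_eq_single k, indicator_of_mem htk]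
  · intro j _ hjk
    exact indicator_of_notMem
      (fun htj => disjoint_left.1 (pairwise_disjoint_gridCell hh hjk) htj htk) _
  · simp

theorem edist_gridStep_rpow (hp : 1 ≤ p) (hp' : p ≠ ∞) (hh : 0 ≤ h) (hN : N * h = T)
    (f : Lp B p (timeMeasure T)) (x : Fin N → B) :
    edist f (gridStep p T h x) ^ p.toReal
      = ∑ k : Fin N, ∫⁻ t in gridCell h k, ‖f t - x k‖ₑ ^ p.toReal ∂timeMeasure T := by
  have hp0 : p ≠ 0 := (one_pos.trans_le hp).ne'
  have hq : 0 < p.toReal := ENNReal.toReal_pos hp0 hp'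
  rw [Lp.edist_def, eLpNorm_eq_lintegral_rpow_enorm_toReal hp0 hp', one_div,
    ENNReal.rpow_inv_rpow hq.ne', lintegral_timeMeasure_eq_sum_gridCell hh hN]
  refine Finset.sum_congr rfl fun k _ => setLIntegral_congr_fun_ae (measurableSet_gridCell h k) ?_
  filter_upwards [coeFn_gridStep hh x] with t ht htk
  rw [Pi.sub_apply, ht k htk]

end GridCell

theorem lintegral_rpow_enorm_le_of_eLpNorm_le {α E : Type*} [MeasurableSpace α]
    [NormedAddCommGroup E] {μ : Measure α} {p : ℝ≥0∞} (hp0 : p ≠ 0) (hp' : p ≠ ∞) {g : α → E}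
    {a : ℝ≥0∞} (hg : eLpNorm g p μ ≤ a) : ∫⁻ t, ‖g t‖ₑ ^ p.toReal ∂μ ≤ a ^ p.toReal := by
  rwa [eLpNorm_eq_lintegral_rpow_enorm_toReal hp0 hp', one_div,
    ENNReal.rpow_inv_le_iff (ENNReal.toReal_pos hp0 hp')] at hg

/-- For `p < ∞`, the elements of `U` are uniformly approximated by step functions on a fixed grid
with values in a fixed sublevel set of the cone. Sampling replaces averaging over the cells, as the
cone need not be convex. -/
theorem totallyBounded_Lp_of_shift {B Y Z : Type*}
    [NormedAddCommGroup B] [NormedSpace ℝ B] [CompleteSpace B]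
    [NormedAddCommGroup Y] [NormedSpace ℝ Y] [AddCommGroup Z] [Module ℝ Z]
    {jB : B →ₗ[ℝ] Z} {jY : Y →ₗ[ℝ] Z} {M : SeminormedNonnegCone B}
    {p : ℝ≥0∞} [hp : Fact (1 ≤ p)] (hp' : p ≠ ∞) {T : ℝ} (hT : 0 < T)
    {U : Set (ℝ →ₘ[timeMeasure T] B)} (hM : M.CompactlyEmbedded)
    (h_mem : ∀ u ∈ U, MemLpConeInter M jB jY p T u) (h_bdd : BoundedInLpCone M p T U)
    (hU : UniformShiftContinuity p T U) :
    TotallyBounded {f : Lp B p (timeMeasure T) | (f : ℝ →ₘ[timeMeasure T] B) ∈ U} := by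
  have hp0 : p ≠ 0 := (one_pos.trans_le hp.out).ne'
  set q := p.toReal with hq
  have hqpos : 0 < q := ENNReal.toReal_pos hp0 hp'
  have hq1 : 1 ≤ q := by simpa using ENNReal.toReal_mono hp' hp.out
  obtain ⟨C, hC⟩ := h_bdd
  set D : ℝ≥0∞ := ENNReal.ofReal (max C 1) ^ q with hDdef
  have hD0 : D ≠ 0 := (ENNReal.rpow_pos (by simp) ENNReal.ofReal_ne_top).ne'
  have hDtop : D ≠ ∞ := ENNReal.rpow_ne_top_of_nonneg hqpos.le ENNReal.ofReal_ne_top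
  refine totallyBounded_of_forall_approx fun ε hε => ?_
  obtain ⟨δ, hδ, Hδ⟩ := hU (ε / 6) (by positivity)
  set c : ℝ≥0∞ := ENNReal.ofReal (ε / 6) ^ q with hc
  have hc0 : c ≠ 0 := (ENNReal.rpow_pos (by simpa using hε) ENNReal.ofReal_ne_top).ne'
  have hctop : c ≠ ∞ := ENNReal.rpow_ne_top_of_nonneg hqpos.le ENNReal.ofReal_ne_top
  obtain ⟨n, hn⟩ := exists_nat_gt (T / δ)
  have hnpos : (0 : ℝ) < n := (div_pos hT hδ).trans hn
  set h := T / n with hh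
  have hhpos : 0 < h := div_pos hT hnpos
  have hhδ : h < δ := by rwa [hh, div_lt_comm₀ hnpos hδ]
  have hnh : n * h = T := mul_div_cancel₀ T hnpos.ne'
  have hh0 : ENNReal.ofReal h ≠ 0 := by simpa using hhpos
  -- This weight makes the two contributions to the average cost comparable.
  set lam : ℝ≥0∞ := ENNReal.ofReal h * c / D with hlam
  have hlam0 : lam ≠ 0 := (ENNReal.div_pos (mul_ne_zero hh0 hc0) hDtop).ne'
  have hlamtop : lam ≠ ∞ :=
    ENNReal.div_ne_top (ENNReal.mul_ne_top ENNReal.ofReal_ne_top hctop) hD0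
  have hlamD : lam * D = ENNReal.ofReal h * c := ENNReal.div_mul_cancel hD0 hDtop
  set R : ℝ≥0∞ := (3 * c / lam) ^ q⁻¹ with hR
  have hRtop : R ≠ ∞ := ENNReal.rpow_ne_top_of_nonneg (by positivity)
    (ENNReal.div_ne_top (ENNReal.mul_ne_top (by simp) hctop) hlam0)
  set K := {m | m ∈ M.carrier ∧ M.bracket m ≤ R.toReal} with hK
  have hKc : IsCompact (closure K) := hM.isCompact_closure_sublevel _
  refine ⟨gridStep p T h '' univ.pi fun _ : Fin n => closure K,
    ((isCompact_univ_pi fun _ => hKc).image continuous_gridStep).totallyBounded, fun f hf => ?_⟩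
  have hfmem := h_mem _ hf
  obtain ⟨r, hrM, hr⟩ := exists_sample_times (u := f) (N := n) (h := h) (T := T)
    (AEEqFun.stronglyMeasurable _) (ψ := fun a => a ^ q) (ENNReal.continuous_rpow_const.measurable)
    (ENNReal.zero_rpow_of_pos hqpos) (b := fun t => ‖M.bracket (f t)‖ₑ ^ q)
    (hfmem.2.2.1.enorm.pow_const q) (P := fun t => f t ∈ M.carrier)
    (hfmem.1.mono fun t ht => ht.1) hhpos hnh (c := c) (D := D) hlamtop
    (fun τ h0 hτ => lintegral_rpow_enorm_le_of_eLpNorm_le hp0 hp' (Hδ τ h0 (hτ.trans hhδ) _ hf))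
    (lintegral_rpow_enorm_le_of_eLpNorm_le hp0 hp' ((hC _ hf).trans
      (ENNReal.ofReal_le_ofReal (le_max_left _ _))))
  have hbound : (ENNReal.ofReal (2 * h) * c + lam * D) / ENNReal.ofReal h = 3 * c := by
    rw [hlamD, ENNReal.ofReal_mul zero_le_two, ENNReal.ofReal_ofNat]
    rw [show 2 * ENNReal.ofReal h * c + ENNReal.ofReal h * c = 3 * c * ENNReal.ofReal h by ring]
    exact ENNReal.mul_div_cancel_right hh0 ENNReal.ofReal_ne_top
  rw [hbound, Finset.sum_add_distrib] at hr
  refine ⟨_, mem_image_of_mem _ (fun k _ => subset_closure ⟨hrM k, ?_⟩ :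
    (fun k => f (r k)) ∈ univ.pi fun _ : Fin n => closure K), ?_⟩
  · have h1 : lam * ‖M.bracket (f (r k))‖ₑ ^ q ≤ 3 * c :=
      (Finset.single_le_sum (f := fun k => lam * ‖M.bracket (f (r k))‖ₑ ^ q)
        (fun _ _ => zero_le) (Finset.mem_univ k)).trans (le_add_self.trans hr)
    have h2 : ‖M.bracket (f (r k))‖ₑ ≤ R := by
      rw [hR, ENNReal.le_rpow_inv_iff hqpos, ENNReal.le_div_iff_mul_le (Or.inl hlam0)
        (Or.inl hlamtop), mul_comm]
      exact h1
    rw [Real.enorm_of_nonneg (M.bracket_nonneg _ (hrM k))] at h2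
    exact (ENNReal.ofReal_le_iff_le_toReal hRtop).1 h2
  · have h1 : edist f (gridStep p T h fun k => f (r k)) ^ q ≤ ENNReal.ofReal (ε / 2) ^ q := by
      calc edist f (gridStep p T h fun k => f (r k)) ^ q
          = ∑ k : Fin n, ∫⁻ t in gridCell h k, ‖f t - f (r k)‖ₑ ^ q ∂timeMeasure T :=
            edist_gridStep_rpow hp.out hp' hhpos.le hnh f _
        _ ≤ 3 * c := le_self_add.trans hr
        _ ≤ 3 ^ q * c := by
            gcongr
            exact ENNReal.le_rpow_self_of_one_le (by norm_num) hq1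
        _ = ENNReal.ofReal (ε / 2) ^ q := by
            rw [hc, ← ENNReal.mul_rpow_of_nonneg _ _ hqpos.le, ← ENNReal.ofReal_ofNat,
              ← ENNReal.ofReal_mul (by norm_num)]
            congr 2
            ring
    rw [ENNReal.rpow_le_rpow_iff hqpos, edist_dist,
      ENNReal.ofReal_le_ofReal_iff (by positivity)] at h1
    linarith

/-! ### The compactness theorem -/

theorem theorem1
    {B Y Z : Type*}
    [NormedAddCommGroup B] [NormedSpace ℝ B] [CompleteSpace B]
    [NormedAddCommGroup Y] [NormedSpace ℝ Y] [CompleteSpace Y]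
    [AddCommGroup Z] [Module ℝ Z]
    (jB : B →ₗ[ℝ] Z) (jY : Y →ₗ[ℝ] Z)
    (hjB : Function.Injective jB) (hjY : Function.Injective jY)
    (M : SeminormedNonnegCone B)
    (hMY : ∃ m ∈ M.carrier, MemOther jB jY m)
    (p : ℝ≥0∞) [Fact (1 ≤ p)] (T : ℝ) (hT : 0 < T)
    (U : Set (ℝ →ₘ[timeMeasure T] B))
    (h_compact : M.CompactlyEmbedded)
    (h_compat : LimitsCompatible jB jY)
    (h_mem : ∀ u ∈ U, MemLpConeInter M jB jY p T u)
    (h_bdd : BoundedInLpCone M p T U)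
    (h_shift : TimeShiftsVanish jB jY p T U) :
    ((∀ u ∈ U, u ∈ Lp B p (timeMeasure T)) ∧
      IsCompact (closure {f : Lp B p (timeMeasure T) | (f : ℝ →ₘ[timeMeasure T] B) ∈ U})) ∧
    (p = ∞ →
      (∀ u ∈ U, ∃ g : C(Icc (0 : ℝ) T, B), RepresentedBy T u g) ∧
      IsCompact (closure {g : C(Icc (0 : ℝ) T, B) | ∃ u ∈ U, RepresentedBy T u g})) := by
  have hp : 1 ≤ p := Fact.out
  have hU : UniformShiftContinuity p T U :=
    uniformShiftContinuity_of_timeShiftsVanish hp hjY h_compact h_compat h_mem h_bdd h_shift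
  have hLp : ∀ u ∈ U, u ∈ Lp B p (timeMeasure T) := fun u hu =>
    Lp.mem_Lp_iff_memLp.2 ((h_mem u hu).memLp h_compact)
  rcases eq_or_ne p ∞ with rfl | hp'
  · obtain ⟨C, hC⟩ := h_bdd
    have hrep : ∀ u ∈ U, ∃ g : C(Icc (0 : ℝ) T, B), RepresentedBy T u g := fun u hu =>
      exists_representedBy hT fun ε hε =>
        let ⟨δ, hδ, H⟩ := hU ε hε
        ⟨δ, hδ, fun τ h0 hτ => H τ h0 hτ u hu⟩
    have hval : ∀ u ∈ U, ∀ᵐ t ∂timeMeasure T,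
        u t ∈ {m | m ∈ M.carrier ∧ M.bracket m ≤ max C 0} := fun u hu => by
      filter_upwards [(h_mem u hu).1, ae_le_eLpNormEssSup (f := fun t => M.bracket (u t))]
        with t ht hb
      refine ⟨ht.1, ?_⟩
      have := hb.trans ((eLpNorm_exponent_top (f := fun t => M.bracket (u t))).symm.trans_le
        (hC u hu))
      rw [Real.enorm_of_nonneg (M.bracket_nonneg _ ht.1)] at this
      exact ENNReal.ofReal_le_ofReal_iff'.1 this |>.elim (fun h => le_max_of_le_left h)
        fun h => le_max_of_le_right h
    have hcpt := isCompact_closure_representatives hT hU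
      (h_compact.isCompact_closure_sublevel (max C 0)) hval
    exact ⟨⟨hLp, isCompact_closure_Lp_top hT hrep hcpt⟩, fun _ => ⟨hrep, hcpt⟩⟩
  · exact ⟨⟨hLp, (totallyBounded_Lp_of_shift hp' hT h_compact h_mem h_bdd hU).closure
      |>.isCompact_of_isClosed isClosed_closure⟩, fun h => absurd h hp'⟩
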